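/- Let the Fibonacci words over the alphabet $\{\mathtt a,\mathtt b\}$ be $F_1=\mathtt b$, $F_2=\mathtt a$ and $F_i=F_{i-1}F_{i-2}$ for $i\ge 3$, and let $f_i=|F_i|$. In a string $T$ (positions counted from $1$), an occurrence is a pair $(s,e)$ with $1\le s\le e\le |T|$; it is an occurrence of the string $T[s\ldots e]$, at position $s$. A string is repeated in $T$ if it has at least two occurrences in $T$, and unique in $T$ if it has exactly one. An occurrence $(s,e)$ is a net occurrence in $T$ if $T[s\ldots e]$ is repeated in $T$ while both $T[s-1\ldots e]$ and $T[s\ldots e+1]$ are unique in $T$, where the first condition on extensions is regarded as satisfied when $s=1$ and the second when $e=|T|$. **Theorem.** For each $i\ge 7$, put $Q_i=F_{i-5}F_{i-6}\cdots F_3F_2$. Then $F_i$ has exactly three net occurrences, namely: the occurrence of $F_{i-2}$ at position $f_{i-1}+1$, and the two occurrences of $F_{i-2}Q_i$ at positions $1$ and $f_{i-2}+1$. -/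

import Mathlib

namespace FibNet

/-- The binary alphabet. -/
inductive Letter
  | a
  | b
  deriving DecidableEq

/-- The Fibonacci word of order `i`: `F 1 = b`, `F 2 = a`, `F i = F (i-1) F (i-2)` for `i ≥ 3`.
The value at `0` is a dummy. -/
def F : ℕ → List Letter
  | 0 => []
  | 1 => [Letter.b]
  | 2 => [Letter.a]
  | n + 3 => F (n + 2) ++ F (n + 1)

/-- The length of the Fibonacci word of order `i`. -/
def f (i : ℕ) : ℕ := (F i).length

/-- For `i ≥ 7`, the concatenation `F (i-5) F (i-6) ⋯ F 3 F 2` (it has `i - 6` factors). -/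
def Q (i : ℕ) : List Letter :=
  ((List.range (i - 6)).map fun k => F (i - 5 - k)).flatten

/-- The substring `T[i … j]`, positions being counted from `1` and both ends included
(meant for `1 ≤ i ≤ j ≤ |T|`). -/
def substring (T : List Letter) (i j : ℕ) : List Letter :=
  (T.drop (i - 1)).take (j + 1 - i)

/-- `o = (i, j)` is an occurrence in `T`: a pair of a starting and an ending position. -/
def IsOccurrence (T : List Letter) (o : ℕ × ℕ) : Prop :=
  1 ≤ o.1 ∧ o.1 ≤ o.2 ∧ o.2 ≤ T.length

/-- `o = (i, j)` is an occurrence of the string `S` in `T`, i.e. `T[i … j] = S`. -/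
def IsOccurrenceOf (T S : List Letter) (o : ℕ × ℕ) : Prop :=
  IsOccurrence T o ∧ substring T o.1 o.2 = S

/-- `S` is repeated in `T`: it has at least two occurrences. -/
def IsRepeated (T S : List Letter) : Prop :=
  ∃ o o' : ℕ × ℕ, o ≠ o' ∧ IsOccurrenceOf T S o ∧ IsOccurrenceOf T S o'

/-- `S` is unique in `T`: it has exactly one occurrence. -/
def IsUnique (T S : List Letter) : Prop :=
  ∃! o : ℕ × ℕ, IsOccurrenceOf T S o

/-- `(i, j)` is a net occurrence in `T`: `T[i … j]` is repeated while the left extension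
`T[i-1 … j]` and the right extension `T[i … j+1]` are unique, where an extension that would
leave `T` counts as unique. -/
def IsNetOccurrence (T : List Letter) (o : ℕ × ℕ) : Prop :=
  IsOccurrence T o ∧ IsRepeated T (substring T o.1 o.2) ∧
    (o.1 = 1 ∨ IsUnique T (substring T (o.1 - 1) o.2)) ∧
    (o.2 = T.length ∨ IsUnique T (substring T o.1 (o.2 + 1)))

/-- The pair of starting and ending positions of a nonempty string `S` placed at position `p`. -/
def place (S : List Letter) (p : ℕ) : ℕ × ℕ := (p, p + S.length - 1)

end FibNet

namespace FibNet

/-! ### Occurrences in terms of letters -/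

/-! Write `p` and `q` for the lengths of F_{i-1} and F_{i-2}. Two windows in F_i, ending at `p - 1`
and `p + q - 1` and starting at `q` and `p`, spell singular words `c w c` (`w` central, `c` a
letter) that occur only once. A repeated window contains neither, so it lies in one of the three
maximal windows avoiding both. Those are repeated: one is the suffix F_{i-2}, also a prefix; the
other two both spell `central (i - 4)`, which is F_{i-2}Q_i. A net occurrence inside a repeated
window is that whole window, so exactly these three remain
(`isNetOccurrence_iff_of_unique_windows`).

Uniqueness of the singular words is carried from F_7 upwards by desubstitution along the Fibonacci
morphism (`occursAtMostOnce_singular`, `occursAtMostOnce_singular'`). -/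

theorem substring_eq_substring_iff {T : List Letter} {s e s' e' : ℕ}
    (h : IsOccurrence T (s, e)) (h' : IsOccurrence T (s', e')) :
    substring T s e = substring T s' e' ↔
      e + s' = e' + s ∧ ∀ j, s + j ≤ e → T[s - 1 + j]? = T[s' - 1 + j]? := by
  obtain ⟨h1, h2, h3⟩ := h
  obtain ⟨h1', h2', h3'⟩ := h'
  simp only at h1 h2 h3 h1' h2' h3'
  constructor
  · intro H
    have hl := congrArg List.length H
    simp only [substring, List.length_take, List.length_drop] at hl
    refine ⟨by omega, fun j hj => ?_⟩
    have := congrArg (fun l => l[j]?) H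
    simp only [substring, List.getElem?_take, List.getElem?_drop] at this
    rwa [if_pos (by omega), if_pos (by omega)] at this
  · rintro ⟨hl, H⟩
    apply List.ext_getElem?
    intro j
    simp only [substring, List.getElem?_take, List.getElem?_drop]
    by_cases hj : s + j ≤ e
    · rw [if_pos (by omega), if_pos (by omega), H j hj]
    · rw [if_neg (by omega), if_neg (by omega)]

theorem isOccurrenceOf_of_append {T x U y : List Letter} (hT : T = x ++ U ++ y) (hU : U ≠ []) :
    IsOccurrenceOf T U (place U (x.length + 1)) := by
  have := List.length_pos_iff.2 hU
  refine ⟨⟨?_, ?_, ?_⟩, ?_⟩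
  · simp [place]
  · simp only [place]; omega
  · simp only [place, hT, List.length_append]; omega
  · simp only [place, substring, hT, Nat.add_sub_cancel, List.append_assoc, List.drop_left]
    rw [show x.length + 1 + U.length - 1 + 1 - (x.length + 1) = U.length by omega, List.take_left]

theorem eq_append_substring {T : List Letter} {s e : ℕ} (h : IsOccurrence T (s, e)) :
    T = T.take (s - 1) ++ substring T s e ++ T.drop e := by
  obtain ⟨h1, h2, h3⟩ := h
  simp only at h1 h2 h3
  have : T.drop e = (T.drop (s - 1)).drop (e + 1 - s) := by
    rw [List.drop_drop]; congr 1; omega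
  rw [substring, this, List.append_assoc, List.take_append_drop, List.take_append_drop]

/-- No two occurrences of `U` in `T` start at different positions. -/
def OccursAtMostOnce (U T : List Letter) : Prop :=
  ∀ x y x' y' : List Letter, T = x ++ U ++ y → T = x' ++ U ++ y' → x = x'

theorem isUnique_of_atMostOnce {T : List Letter} {s e s₀ e₀ : ℕ} (h : IsOccurrence T (s, e))
    (h₀ : IsOccurrence T (s₀, e₀)) (hs : s ≤ s₀) (he : e₀ ≤ e)
    (hU : OccursAtMostOnce (substring T s₀ e₀) T) : IsUnique T (substring T s e) := by
  refine ⟨(s, e), ⟨h, rfl⟩, ?_⟩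
  rintro ⟨s', e'⟩ ⟨h', heq⟩
  simp only at heq
  obtain ⟨hl, H⟩ := (substring_eq_substring_iff h h').1 heq.symm
  have hh := h
  have hh' := h'
  have hh₀ := h₀
  simp only [IsOccurrence] at hh hh' hh₀
  have h₁ : IsOccurrence T (s' + (s₀ - s), e' - (e - e₀)) := ⟨by omega, by omega, by omega⟩
  have hsub : substring T s₀ e₀ = substring T (s' + (s₀ - s)) (e' - (e - e₀)) := by
    rw [substring_eq_substring_iff h₀ h₁]
    refine ⟨by omega, fun j hj => ?_⟩
    have := H (s₀ - s + j) (by omega)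
    rwa [show s - 1 + (s₀ - s + j) = s₀ - 1 + j by omega,
      show s' - 1 + (s₀ - s + j) = s' + (s₀ - s) - 1 + j by omega] at this
  have e1 := eq_append_substring h₀
  have e2 := eq_append_substring h₁
  rw [← hsub] at e2
  have := congrArg List.length (hU _ _ _ _ e1 e2)
  simp only [List.length_take] at this
  ext <;> simp only <;> omega

theorem IsRepeated.mono {T : List Letter} {s e s₀ e₀ : ℕ} (h : IsOccurrence T (s, e))
    (h₀ : IsOccurrence T (s₀, e₀)) (hs : s ≤ s₀) (he : e₀ ≤ e)
    (hr : IsRepeated T (substring T s e)) : IsRepeated T (substring T s₀ e₀) := by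
  have shift : ∀ s' e', IsOccurrenceOf T (substring T s e) (s', e') →
      e' + s = e + s' ∧
        IsOccurrenceOf T (substring T s₀ e₀) (s' + (s₀ - s), s' + (s₀ - s) + (e₀ - s₀)) := by
    rintro s' e' ⟨h', heq⟩
    simp only at heq
    obtain ⟨hl, H⟩ := (substring_eq_substring_iff h h').1 heq.symm
    have hh := h
    have hh' := h'
    have hh₀ := h₀
    simp only [IsOccurrence] at hh hh' hh₀
    have h₁ : IsOccurrence T (s' + (s₀ - s), s' + (s₀ - s) + (e₀ - s₀)) :=
      ⟨by omega, by omega, by simp only; omega⟩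
    refine ⟨by omega, h₁, Eq.symm ?_⟩
    rw [substring_eq_substring_iff h₀ h₁]
    refine ⟨by omega, fun j hj => ?_⟩
    have := H (s₀ - s + j) (by omega)
    rwa [show s - 1 + (s₀ - s + j) = s₀ - 1 + j by omega,
      show s' - 1 + (s₀ - s + j) = s' + (s₀ - s) - 1 + j by omega] at this
  obtain ⟨⟨s₁, e₁⟩, ⟨s₂, e₂⟩, hne, ho₁, ho₂⟩ := hr
  obtain ⟨hl₁, hr₁⟩ := shift _ _ ho₁
  obtain ⟨hl₂, hr₂⟩ := shift _ _ ho₂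
  refine ⟨_, _, fun heq => hne ?_, hr₁, hr₂⟩
  simp only [Prod.mk.injEq] at heq
  ext <;> simp only <;> omega

theorem IsRepeated.not_isUnique {T S : List Letter} (h : IsRepeated T S) : ¬ IsUnique T S := by
  rintro ⟨_, _, hu⟩
  obtain ⟨o, o', hne, ho, ho'⟩ := h
  exact hne ((hu o ho).trans (hu o' ho').symm)

/-- If the inclusion were strict, a one-letter extension would still fit in the repeated window and
so be repeated, not unique. -/
theorem IsNetOccurrence.eq_of_subset {T : List Letter} {s e s' e' : ℕ}
    (h : IsNetOccurrence T (s, e)) (h' : IsOccurrence T (s', e')) (hs : s' ≤ s) (he : e ≤ e')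
    (hr : IsRepeated T (substring T s' e')) : (s, e) = (s', e') := by
  obtain ⟨ho, -, hl, hr'⟩ := h
  have hh := ho
  have hh' := h'
  simp only [IsOccurrence] at hh hh' hl hr'
  by_contra hne
  rw [Prod.mk.injEq] at hne
  by_cases hse : s' = s
  · have hlt : e < e' := by omega
    refine (IsRepeated.mono h' (s₀ := s) (e₀ := e + 1) ?_ hs hlt hr).not_isUnique
      (hr'.resolve_left (by omega))
    exact ⟨by omega, by simp only; omega, by simp only; omega⟩
  · refine (IsRepeated.mono h' (s₀ := s - 1) (e₀ := e) ?_ (by omega) he hr).not_isUnique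
      (hl.resolve_left (by omega))
    exact ⟨by simp only; omega, by simp only; omega, by simp only; omega⟩

/-- The net occurrences of a text of length `p + q` in which the windows `(q, p - 1)` and
`(p, p + q - 1)` are unique while the three maximal windows that avoid them are repeated. -/
theorem isNetOccurrence_iff_of_unique_windows {T : List Letter} {p q : ℕ} (hq : 2 ≤ q)
    (hpq : q + 2 ≤ p) (hT : T.length = p + q)
    (hA : IsRepeated T (substring T 1 (p - 2)))
    (hB : IsRepeated T (substring T (q + 1) (p + q - 2)))
    (hC : IsRepeated T (substring T (p + 1) (p + q)))
    (hW : OccursAtMostOnce (substring T q (p - 1)) T)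
    (hW' : OccursAtMostOnce (substring T p (p + q - 1)) T) (o : ℕ × ℕ) :
    IsNetOccurrence T o ↔
      o = (p + 1, p + q) ∨ o = (1, p - 2) ∨ o = (q + 1, p + q - 2) := by
  have occ : ∀ s e, 1 ≤ s → s ≤ e → e ≤ p + q → IsOccurrence T (s, e) :=
    fun s e h1 h2 h3 => ⟨h1, h2, hT ▸ h3⟩
  have uniq : ∀ s e, 1 ≤ s → s ≤ q → p - 1 ≤ e → e ≤ p + q → IsUnique T (substring T s e) :=
    fun s e h1 h2 h3 h4 => isUnique_of_atMostOnce (occ _ _ h1 (by omega) h4)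
      (occ q (p - 1) (by omega) (by omega) (by omega)) h2 h3 hW
  have uniq' : ∀ s e, 1 ≤ s → s ≤ p → p + q - 1 ≤ e → e ≤ p + q →
      IsUnique T (substring T s e) :=
    fun s e h1 h2 h3 h4 => isUnique_of_atMostOnce (occ _ _ h1 (by omega) h4)
      (occ p (p + q - 1) (by omega) (by omega) (by omega)) h2 h3 hW'
  constructor
  · obtain ⟨s, e⟩ := o
    intro h
    have hh := h.1
    simp only [IsOccurrence] at hh
    -- The start decides which unique windows can still be contained; the end must then stop short
    -- of the first of them.
    by_cases h1 : p + 1 ≤ s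
    · exact .inl (h.eq_of_subset (occ _ _ (by omega) (by omega) le_rfl) h1 (by omega) hC)
    by_cases h2 : q + 1 ≤ s
    · by_cases h3 : e ≤ p + q - 2
      · exact .inr (.inr (h.eq_of_subset (occ _ _ (by omega) (by omega) (by omega)) h2 h3 hB))
      · exact absurd (uniq' s e hh.1 (by omega) (by omega) (by omega)) h.2.1.not_isUnique
    · by_cases h3 : e ≤ p - 2
      · exact .inr (.inl (h.eq_of_subset (occ _ _ le_rfl (by omega) (by omega)) hh.1 h3 hA))
      · exact absurd (uniq s e hh.1 (by omega) (by omega) (by omega)) h.2.1.not_isUnique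
  · rintro (rfl | rfl | rfl)
    · exact ⟨occ _ _ (by omega) (by omega) le_rfl, hC,
        .inr (uniq' _ _ (by simp only; omega) (by simp) (by simp only; omega) le_rfl),
        .inl hT.symm⟩
    · exact ⟨occ _ _ le_rfl (by omega) (by omega), hA, .inl rfl,
        .inr (uniq _ _ le_rfl (by simp only; omega) (by simp only; omega) (by simp only; omega))⟩
    · exact ⟨occ _ _ (by omega) (by omega) (by omega), hB,
        .inr (uniq _ _ (by simp only; omega) (by simp) (by simp only; omega)
          (by simp only; omega)),
        .inr (uniq' _ _ (by simp only; omega) (by simp only; omega) (by simp only; omega)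
          (by simp only; omega))⟩

/-! ### The Fibonacci morphism -/

/-- The Fibonacci morphism `a ↦ ab`, `b ↦ a`. -/
def morph : List Letter → List Letter
  | [] => []
  | .a :: l => .a :: .b :: morph l
  | .b :: l => .a :: morph l

theorem morph_append (u v : List Letter) : morph (u ++ v) = morph u ++ morph v := by
  induction u with
  | nil => rfl
  | cons c u ih => cases c <;> simp [morph, ih]

/-- Every block `ab` or `a` starts with its only `a`, so a cut before an `a` is a cut between
blocks. -/
theorem exists_of_morph_eq_append_a {T x z : List Letter} (h : morph T = x ++ .a :: z) :
    ∃ u v, T = u ++ v ∧ morph u = x ∧ morph v = .a :: z := by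
  induction T generalizing x with
  | nil => simp [morph] at h
  | cons c T ih =>
    rcases x with _ | ⟨d, x⟩
    · exact ⟨[], c :: T, rfl, rfl, h⟩
    · cases c
      · rcases x with _ | ⟨d', x⟩
        · simp [morph] at h
        · simp only [morph, List.cons_append, List.cons.injEq] at h
          obtain ⟨rfl, rfl, h⟩ := h
          obtain ⟨u, v, rfl, rfl, hv⟩ := ih h
          exact ⟨.a :: u, v, rfl, rfl, hv⟩
      · simp only [morph, List.cons_append, List.cons.injEq] at h
        obtain ⟨rfl, h⟩ := h
        obtain ⟨u, v, rfl, rfl, hv⟩ := ih h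
        exact ⟨.b :: u, v, rfl, rfl, hv⟩

theorem exists_of_morph_eq_append_b {T x z : List Letter} (h : morph T = x ++ .b :: z) :
    ∃ u v, T = u ++ .a :: v ∧ x = morph u ++ [.a] ∧ z = morph v := by
  induction T generalizing x with
  | nil => simp [morph] at h
  | cons c T ih =>
    rcases x with _ | ⟨d, x⟩
    · cases c <;> simp [morph] at h
    · cases c
      · rcases x with _ | ⟨d', x⟩
        · simp only [morph, List.cons_append, List.nil_append, List.cons.injEq, true_and] at h
          obtain ⟨rfl, rfl⟩ := h
          exact ⟨[], T, rfl, rfl, rfl⟩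
        · simp only [morph, List.cons_append, List.cons.injEq] at h
          obtain ⟨rfl, rfl, h⟩ := h
          obtain ⟨u, v, rfl, rfl, hv⟩ := ih h
          exact ⟨.a :: u, v, rfl, rfl, hv⟩
      · simp only [morph, List.cons_append, List.cons.injEq] at h
        obtain ⟨rfl, h⟩ := h
        obtain ⟨u, v, rfl, rfl, hv⟩ := ih h
        exact ⟨.b :: u, v, rfl, rfl, hv⟩

/-- The `a` after `morph w` matters: without it, a final `b` of `w` could match the first half of a
block `ab`. -/
theorem exists_of_morph_eq_morph_append {v w y : List Letter}
    (h : morph v = morph w ++ .a :: y) : ∃ v', v = w ++ v' ∧ morph v' = .a :: y := by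
  induction w generalizing v with
  | nil => exact ⟨v, rfl, h⟩
  | cons c w ih =>
    rcases v with _ | ⟨d, v⟩
    · cases c <;> simp [morph] at h
    · cases c <;> cases d
      · simp only [morph, List.cons_append, List.cons.injEq, true_and] at h
        obtain ⟨v', rfl, hv'⟩ := ih h
        exact ⟨v', rfl, hv'⟩
      · rcases v with _ | ⟨d, v⟩
        · simp [morph] at h
        · cases d <;> simp [morph] at h
      · rcases w with _ | ⟨d, w⟩
        · simp [morph] at h
        · cases d <;> simp [morph] at h
      · simp only [morph, List.cons_append, List.cons.injEq, true_and] at h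
        obtain ⟨v', rfl, hv'⟩ := ih h
        exact ⟨v', rfl, hv'⟩

/-- The word is `morph (b g b)` followed by `a`, which forces the last block to be `a`; each
occurrence thus desubstitutes. -/
theorem OccursAtMostOnce.morph_b {g T : List Letter}
    (h : OccursAtMostOnce (.b :: g ++ [.b]) T) :
    OccursAtMostOnce (.a :: (morph g ++ [.a]) ++ [.a]) (morph T) := by
  have key : ∀ x y, morph T = x ++ (.a :: (morph g ++ [.a]) ++ [.a]) ++ y →
      ∃ u v, T = u ++ (.b :: g ++ [.b]) ++ v ∧ morph u = x := by
    intro x y hx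
    obtain ⟨u, v, rfl, rfl, hv⟩ := exists_of_morph_eq_append_a
      (z := morph g ++ [.a] ++ [.a] ++ y) (by simpa using hx)
    obtain ⟨v', rfl, -⟩ := exists_of_morph_eq_morph_append (v := v) (w := .b :: g ++ [.b])
      (y := y) (by rw [hv]; simp [morph, morph_append])
    exact ⟨u, v', by simp, rfl⟩
  intro x y x' y' hx hx'
  obtain ⟨u, v, hu, rfl⟩ := key x y hx
  obtain ⟨u', v', hu', rfl⟩ := key x' y' hx'
  rw [h _ _ _ _ hu hu']

/-- The word is `morph (a g a)` without its first `a`, which the leading `b` forces back. -/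
theorem OccursAtMostOnce.morph_a {g T : List Letter}
    (h : OccursAtMostOnce (.a :: g ++ [.a]) T) :
    OccursAtMostOnce (.b :: (morph g ++ [.a]) ++ [.b]) (morph T) := by
  have key : ∀ x y, morph T = x ++ (.b :: (morph g ++ [.a]) ++ [.b]) ++ y →
      ∃ u v, T = u ++ (.a :: g ++ [.a]) ++ v ∧ x = morph u ++ [.a] := by
    intro x y hx
    obtain ⟨u, v, rfl, rfl, hv⟩ := exists_of_morph_eq_append_b
      (z := morph g ++ .a :: .b :: y) (by simpa using hx)
    obtain ⟨v', rfl, hv'⟩ := exists_of_morph_eq_morph_append hv.symm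
    rcases v' with _ | ⟨d, v'⟩
    · simp [morph] at hv'
    · cases d
      · exact ⟨u, v', by simp, rfl⟩
      · rcases v' with _ | ⟨d, v'⟩
        · simp [morph] at hv'
        · cases d <;> simp [morph] at hv'
  intro x y x' y' hx hx'
  obtain ⟨u, v, hu, rfl⟩ := key x y hx
  obtain ⟨u', v', hu', rfl⟩ := key x' y' hx'
  rw [h _ _ _ _ hu hu']

/-! ### Central words -/

theorem F_succ_eq_morph (n : ℕ) : F (n + 2) = morph (F (n + 1)) := by
  induction n using Nat.strong_induction_on with
  | _ n ih =>
    match n with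
    | 0 => rfl
    | 1 => rfl
    | n + 2 =>
      rw [show F (n + 2 + 1) = F (n + 2) ++ F (n + 1) from rfl, morph_append,
        ← ih (n + 1) (by omega), ← ih n (by omega)]
      rfl

/-- The word obtained from `F (k + 3)` by deleting its last two letters. -/
def central : ℕ → List Letter
  | 0 => []
  | k + 1 => morph (central k) ++ [.a]

/-- The letters `a` and `b` in alternation; `last k` ends `F (k + 2)`. -/
def last : ℕ → Letter
  | 0 => .a
  | 1 => .b
  | k + 2 => last k

theorem last_cases (k : ℕ) :
    last k = .a ∧ last (k + 1) = .b ∨ last k = .b ∧ last (k + 1) = .a := by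
  induction k with
  | zero => exact .inl ⟨rfl, rfl⟩
  | succ k ih => exact ih.elim (fun h => .inr ⟨h.2, h.1⟩) fun h => .inl ⟨h.2, h.1⟩

theorem F_eq_central (k : ℕ) : F (k + 3) = central k ++ [last k, last (k + 1)] := by
  induction k with
  | zero => rfl
  | succ k ih =>
    rw [F_succ_eq_morph (k + 2), ih, morph_append, central]
    rcases last_cases k with ⟨h, h'⟩ | ⟨h, h'⟩ <;> simp [last, h, h', morph]

/-- Near-commutation: exchanging the two factors of `F (k + 3)` swaps only its last two letters. -/
theorem F_append_F (k : ℕ) :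
    F (k + 1) ++ F (k + 2) = central k ++ [last (k + 1), last k] := by
  induction k with
  | zero => rfl
  | succ k ih =>
    rw [show F (k + 1 + 1) ++ F (k + 1 + 2) = morph (F (k + 1)) ++ morph (F (k + 2)) from
        congrArg₂ _ (F_succ_eq_morph k) (F_succ_eq_morph (k + 1)),
      ← morph_append, ih, morph_append, central]
    rcases last_cases k with ⟨h, h'⟩ | ⟨h, h'⟩ <;> simp [last, h, h', morph]

theorem exists_F_eq_append_last (k : ℕ) : ∃ x, F (k + 2) = x ++ [last k] := by
  rcases k with _ | k
  · exact ⟨[], rfl⟩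
  · exact ⟨central k ++ [last k], by simp [F_eq_central k]⟩

theorem central_add_two (k : ℕ) : central (k + 2) = F (k + 4) ++ central k := by
  have h : F (k + 5) = F (k + 4) ++ F (k + 3) := rfl
  rw [F_eq_central (k + 2), F_eq_central k] at h
  exact List.append_cancel_right (h.trans (List.append_assoc _ _ _).symm)

theorem central_succ (k : ℕ) : central (k + 1) = F (k + 2) ++ central k := by
  have h := F_append_F (k + 1)
  rw [F_eq_central k, ← List.append_assoc] at h
  exact (List.append_cancel_right h).symm

theorem Q_eq_central (k : ℕ) : Q (k + 6) = central k := by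
  induction k with
  | zero => rfl
  | succ k ih =>
    rw [central_succ, ← ih]
    simp only [Q, show k + 1 + 6 - 6 = k + 1 by omega, show k + 6 - 6 = k by omega,
      List.range_succ_eq_map, List.map_cons, List.map_map, List.flatten_cons]
    congr 2
    apply List.map_congr_left
    intro j _
    simp only [Function.comp]
    congr 1
    omega

/-! ### Uniqueness of the singular words -/

/-- Bounded positions make the base cases in `F 7` decidable. -/
theorem occursAtMostOnce_of_forall {U T : List Letter}
    (h : ∀ m ≤ T.length, ∀ n ≤ T.length, (T.drop m).take U.length = U →
      (T.drop n).take U.length = U → m = n) : OccursAtMostOnce U T := by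
  have key : ∀ x y, T = x ++ U ++ y →
      x.length ≤ T.length ∧ (T.drop x.length).take U.length = U ∧ x = T.take x.length := by
    rintro x y rfl
    exact ⟨by simp only [List.length_append]; omega, by simp, by simp⟩
  intro x y x' y' hx hx'
  obtain ⟨h1, h2, h3⟩ := key x y hx
  obtain ⟨h1', h2', h3'⟩ := key x' y' hx'
  rw [h3, h3', h _ h1 _ h1' h2 h2']

theorem occursAtMostOnce_singular_step {g : List Letter} {k n : ℕ}
    (h : OccursAtMostOnce (last k :: g ++ [last k]) (F (n + 1))) :
    OccursAtMostOnce (last (k + 1) :: (morph g ++ [.a]) ++ [last (k + 1)]) (F (n + 2)) := by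
  rw [F_succ_eq_morph]
  rcases last_cases k with ⟨h1, h2⟩ | ⟨h1, h2⟩ <;> rw [h1] at h <;> rw [h2]
  · exact h.morph_a
  · exact h.morph_b

theorem occursAtMostOnce_singular (k : ℕ) :
    OccursAtMostOnce (last (k + 1) :: central (k + 1) ++ [last (k + 1)]) (F (k + 7)) := by
  induction k with
  | zero => exact occursAtMostOnce_of_forall (by decide)
  | succ k ih => exact occursAtMostOnce_singular_step ih

theorem occursAtMostOnce_singular' (k : ℕ) :
    OccursAtMostOnce (last k :: central (k + 2) ++ [last k]) (F (k + 7)) := by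
  induction k with
  | zero => exact occursAtMostOnce_of_forall (by decide)
  | succ k ih => exact occursAtMostOnce_singular_step ih

theorem f_add_two (n : ℕ) (hn : 1 ≤ n) : f (n + 2) = f (n + 1) + f n := by
  obtain ⟨n, rfl⟩ := Nat.exists_eq_add_of_le' hn
  simp [f, F]

theorem length_central (k : ℕ) : (central k).length + 2 = f (k + 3) := by
  simp [f, F_eq_central k]

end FibNet

/-! ### The windows inside `F (k + 7)` -/

open FibNet in
theorem mainTheorem1 (i : ℕ) (hi : 7 ≤ i) :
    FibNet.IsOccurrenceOf (FibNet.F i) (FibNet.F (i - 2))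
        (FibNet.place (FibNet.F (i - 2)) (FibNet.f (i - 1) + 1)) ∧
      FibNet.IsOccurrenceOf (FibNet.F i) (FibNet.F (i - 2) ++ FibNet.Q i)
        (FibNet.place (FibNet.F (i - 2) ++ FibNet.Q i) 1) ∧
      FibNet.IsOccurrenceOf (FibNet.F i) (FibNet.F (i - 2) ++ FibNet.Q i)
        (FibNet.place (FibNet.F (i - 2) ++ FibNet.Q i) (FibNet.f (i - 2) + 1)) ∧
      {o : ℕ × ℕ | FibNet.IsNetOccurrence (FibNet.F i) o} =
        {FibNet.place (FibNet.F (i - 2)) (FibNet.f (i - 1) + 1),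
          FibNet.place (FibNet.F (i - 2) ++ FibNet.Q i) 1,
          FibNet.place (FibNet.F (i - 2) ++ FibNet.Q i) (FibNet.f (i - 2) + 1)} ∧
      {o : ℕ × ℕ | FibNet.IsNetOccurrence (FibNet.F i) o}.ncard = 3 := by
  obtain ⟨k, rfl⟩ := Nat.exists_eq_add_of_le' hi
  rw [show k + 7 - 2 = k + 5 by omega, show k + 7 - 1 = k + 6 by omega,
    Q_eq_central (k + 1), ← central_add_two (k + 1)]
  have hF : F (k + 7) = F (k + 6) ++ F (k + 5) := rfl
  have hF6 : F (k + 6) = F (k + 5) ++ F (k + 4) := rfl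
  have h4 : 3 ≤ f (k + 4) := by
    have : (central (k + 1)).length + 2 = f (k + 4) := length_central (k + 1)
    simp only [central, List.length_append, List.length_singleton] at this
    omega
  have h5 : f (k + 4) < f (k + 5) := by
    have := f_add_two (k + 3) (by omega)
    have := length_central k
    simp only [Nat.add_assoc, Nat.reduceAdd] at *
    omega
  have h6 : f (k + 6) = f (k + 5) + f (k + 4) := f_add_two (k + 4) (by omega)
  have h7 : f (k + 7) = f (k + 6) + f (k + 5) := f_add_two (k + 5) (by omega)
  have hc : (central (k + 3)).length = f (k + 6) - 2 := by
    have := length_central (k + 3)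
    simp only [Nat.add_assoc, Nat.reduceAdd] at this
    omega
  have hc0 : central (k + 3) ≠ [] := List.length_pos_iff.1 (by omega)
  have hF50 : F (k + 5) ≠ [] := List.length_pos_iff.1 (show 0 < f (k + 5) by omega)
  -- the three windows
  have oC : IsOccurrenceOf (F (k + 7)) (F (k + 5)) (place (F (k + 5)) (f (k + 6) + 1)) :=
    isOccurrenceOf_of_append (y := []) (by simp [hF]) hF50
  have oC' : IsOccurrenceOf (F (k + 7)) (F (k + 5)) (place (F (k + 5)) 1) :=
    isOccurrenceOf_of_append (x := []) (y := F (k + 4) ++ F (k + 5)) (by simp [hF, hF6]) hF50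
  have oA : IsOccurrenceOf (F (k + 7)) (central (k + 3)) (place (central (k + 3)) 1) :=
    isOccurrenceOf_of_append (x := []) (y := [last (k + 3), last (k + 4)] ++ F (k + 5))
      (by rw [hF, F_eq_central (k + 3)]; simp) hc0
  -- After the prefix `F (k + 5)` the remaining factors are `F (k + 4) ++ F (k + 5)`, so
  -- near-commutation applies.
  have oB : IsOccurrenceOf (F (k + 7)) (central (k + 3))
      (place (central (k + 3)) (f (k + 5) + 1)) :=
    isOccurrenceOf_of_append (y := [last (k + 4), last (k + 3)])
      (by rw [hF, hF6, List.append_assoc, F_append_F (k + 3), List.append_assoc]) hc0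
  have pC : place (F (k + 5)) (f (k + 6) + 1) = (f (k + 6) + 1, f (k + 6) + f (k + 5)) := by
    have : (F (k + 5)).length = f (k + 5) := rfl
    ext <;> simp only [place]; omega
  have pA : place (central (k + 3)) 1 = (1, f (k + 6) - 2) := by
    ext <;> simp only [place, hc]; omega
  have pB : place (central (k + 3)) (f (k + 5) + 1) =
      (f (k + 5) + 1, f (k + 6) + f (k + 5) - 2) := by
    ext <;> simp only [place, hc]; omega
  -- the two unique windows
  have oW : IsOccurrenceOf (F (k + 7)) (last (k + 1) :: central (k + 1) ++ [last (k + 1)])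
      (f (k + 5), f (k + 6) - 1) := by
    obtain ⟨x, hx⟩ := exists_F_eq_append_last (k + 3)
    have hl : x.length + 1 = f (k + 5) := by
      have := congrArg List.length hx
      simpa [f] using this.symm
    have := isOccurrenceOf_of_append (T := F (k + 7)) (x := x)
      (U := last (k + 1) :: central (k + 1) ++ [last (k + 1)]) (y := [last (k + 2)] ++ F (k + 5))
      (by
        have h4' : F (k + 4) = central (k + 1) ++ [last (k + 1), last (k + 2)] :=
          F_eq_central (k + 1)
        -- `last (k + 3)` reduces to `last (k + 1)`, so the letters on both sides of `central (k +
        -- 1)` agree.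
        have hx' : F (k + 5) = x ++ [last (k + 1)] := hx
        rw [hF, hF6, h4']
        nth_rewrite 1 [hx']
        simp) (by simp)
    convert this using 1
    have hc1 : (central (k + 1)).length + 2 = f (k + 4) := length_central (k + 1)
    ext <;> simp [place] <;> omega
  have oW' : IsOccurrenceOf (F (k + 7)) (last k :: central (k + 2) ++ [last k])
      (f (k + 6), f (k + 6) + f (k + 5) - 1) := by
    obtain ⟨x, hx⟩ := exists_F_eq_append_last (k + 4)
    have hl : x.length + 1 = f (k + 6) := by
      have := congrArg List.length hx
      simpa [f] using this.symm
    have := isOccurrenceOf_of_append (T := F (k + 7)) (x := x)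
      (U := last k :: central (k + 2) ++ [last k]) (y := [last (k + 1)])
      (by
        have h5' : F (k + 5) = central (k + 2) ++ [last k, last (k + 1)] :=
          F_eq_central (k + 2)
        have hx' : F (k + 6) = x ++ [last k] := hx
        rw [hF, h5', hx']
        simp) (by simp)
    convert this using 1
    have hc1 : (central (k + 2)).length + 2 = f (k + 5) := length_central (k + 2)
    ext <;> simp [place] <;> omega
  have hset : {o : ℕ × ℕ | IsNetOccurrence (F (k + 7)) o} =
      {place (F (k + 5)) (f (k + 6) + 1), place (central (k + 3)) 1,
        place (central (k + 3)) (f (k + 5) + 1)} := by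
    have rA : IsRepeated (F (k + 7)) (central (k + 3)) :=
      ⟨_, _, by rw [pA, pB, Ne, Prod.mk.injEq]; omega, oA, oB⟩
    have rC : IsRepeated (F (k + 7)) (F (k + 5)) :=
      ⟨_, _, by simp only [place, Ne, Prod.mk.injEq]; omega, oC, oC'⟩
    rw [pA] at oA
    rw [pB] at oB
    rw [pC] at oC
    ext o
    rw [pA, pB, pC]
    exact isNetOccurrence_iff_of_unique_windows (by omega) (by omega) h7
      (by rw [oA.2]; exact rA) (by rw [oB.2]; exact rA) (by rw [oC.2]; exact rC)
      (by rw [oW.2]; exact occursAtMostOnce_singular k)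
      (by rw [oW'.2]; exact occursAtMostOnce_singular' k) o
  refine ⟨oC, oA, oB, hset, ?_⟩
  rw [hset, Set.ncard_eq_three]
  refine ⟨_, _, _, ?_, ?_, ?_, rfl⟩ <;> simp only [place, Ne, Prod.mk.injEq] <;> omega
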